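/- Let $\beta>0$ be fixed. On $d\ge 1$ qubits let $H=\sum_{i=1}^d X_i$ (the adjacency matrix of the $d$-dimensional hypercube graph), and take the $d$ jump operators $A^a=\frac{1}{\sqrt d}Z_a$, $a=1,\dots,d$, where $X_i,Z_a$ are Pauli operators acting on one qubit. For $\sigma_E>0$ put $$f(t)=e^{-\sigma_E^2t^2}\sqrt{\sigma_E\sqrt{2/\pi}},\qquad \hat f(\omega)=\frac{1}{\sqrt{\sigma_E\sqrt{2\pi}}}\,e^{-\omega^2/(4\sigma_E^2)},\qquad \gamma(\omega)=\exp\!\Big(-\beta\max\big(\omega+\tfrac{\beta\sigma_E^2}{2},0\big)\Big),$$ $$\hat A^a(\omega)=\frac{1}{\sqrt{2\pi}}\int_{-\infty}^{\infty}e^{iHt}A^ae^{-iHt}e^{-i\omega t}f(t)\,dt,\qquad \theta(\nu_1,\nu_2)=\int_{-\infty}^\infty \hat f(\omega-\nu_1)\hat f(\omega-\nu_2)\gamma(\omega)\,d\omega .$$ For a Bohr frequency (difference of two eigenvalues of $H$) $\nu$ let $A^a_\nu=\sum_{E-E'=\nu}P_EA^aP_{E'}$, where $P_E$ is the spectral projection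 of $H$ for the eigenvalue $E$. Let $$B=\sum_a\sum_{\nu_1,\nu_2}\frac{\tanh(-\beta(\nu_1-\nu_2)/4)}{2i}\,\theta(\nu_1,\nu_2)\,(A^a_{\nu_2})^\dagger A^a_{\nu_1},$$ the sum over all Bohr frequencies $\nu_1,\nu_2$ of $H$. The CKG Lindbladian is the superoperator $$\mathcal L_\beta[X]=-i[B,X]+\sum_{a}\int_{-\infty}^{\infty}\gamma(\omega)\Big(\hat A^a(\omega)X\hat A^a(\omega)^\dagger-\tfrac12\{\hat A^a(\omega)^\dagger\hat A^a(\omega),X\}\Big)\,d\omega .$$ Its spectral gap is $\lambda_{\mathrm{gap}}(\mathcal L_\beta)=\min_{j>1}|\lambda_j|$, where $\lambda_1=0,\lambda_2,\dots,\lambda_{4^d}$ are the eigenvalues of $\mathcal L_\beta$ with algebraic multiplicity. Then there is an energy resolution $\sigma_E>0$, depending only on $\beta$, for which $\lambda_{\mathrm{gap}}(\mathcal L_\beta)=\Omega(1/d)$; precisely, there are $\sigma_E>0$ and $c>0$, depending only on $\beta$, such that $\lambda_{\mathrm{gap}}(\mathcal L_\beta)\ge c/d$ for every $d\ge 1$.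 -/

import Mathlib

open scoped Matrix

noncomputable section

namespace CKG

/-! ## The CKG Lindbladian of a finite-dimensional system -/

section General

variable {n : Type*} [Fintype n] [DecidableEq n]

/-- The Gaussian time filter `f(t) = exp(-σ² t²) √(σ √(2/π))`, normalized in `L²`. -/
def timeFilter (σ t : ℝ) : ℝ :=
  Real.exp (-σ ^ 2 * t ^ 2) * Real.sqrt (σ * Real.sqrt (2 / Real.pi))

/-- The Fourier transform `f̂(ω) = exp(-ω² / (4σ²)) / √(σ √(2π))` of the time filter. -/
def freqFilter (σ ω : ℝ) : ℝ :=
  1 / Real.sqrt (σ * Real.sqrt (2 * Real.pi)) * Real.exp (-ω ^ 2 / (4 * σ ^ 2))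

/-- The shifted Metropolis weight `γ(ω) = exp(-β max(ω + β σ² / 2, 0))`. -/
def metropolis (β σ ω : ℝ) : ℝ :=
  Real.exp (-β * max (ω + β * σ ^ 2 / 2) 0)

/-- `θ(ν₁, ν₂) = ∫ f̂(ω - ν₁) f̂(ω - ν₂) γ(ω) dω`. -/
def theta (β σ ν₁ ν₂ : ℝ) : ℝ :=
  ∫ ω : ℝ, freqFilter σ (ω - ν₁) * freqFilter σ (ω - ν₂) * metropolis β σ ω

/-- Heisenberg evolution `e^{iHt} A e^{-iHt}`. -/
def heisenberg (H A : Matrix n n ℂ) (t : ℝ) : Matrix n n ℂ :=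
  NormedSpace.exp ((Complex.I * (t : ℂ)) • H) * A *
    NormedSpace.exp ((-(Complex.I * (t : ℂ))) • H)

/-- The operator Fourier transform
`Â(ω) = (2π)^{-1/2} ∫ e^{iHt} A e^{-iHt} e^{-iωt} f(t) dt`, the integral taken entrywise. -/
def oft (σ : ℝ) (H A : Matrix n n ℂ) (ω : ℝ) : Matrix n n ℂ :=
  Matrix.of fun i j =>
    ((1 / Real.sqrt (2 * Real.pi) : ℝ) : ℂ) *
      ∫ t : ℝ, heisenberg H A t i j * Complex.exp (-(Complex.I * (ω : ℂ) * (t : ℂ))) *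
        (timeFilter σ t : ℂ)

/-- The dissipator `X ↦ K X K† - ½ {K† K, X}` of a Lindblad operator `K`. -/
def dissipator (K : Matrix n n ℂ) : Matrix n n ℂ →ₗ[ℂ] Matrix n n ℂ where
  toFun X := K * X * Kᴴ - (1 / 2 : ℂ) • (Kᴴ * K * X + X * (Kᴴ * K))
  map_add' X Y := by
    simp only [mul_add, add_mul, smul_add]; abel
  map_smul' c X := by
    simp only [mul_smul_comm, smul_mul_assoc, smul_add, smul_sub, RingHom.id_apply,
      smul_comm c (1 / 2 : ℂ)]

/-- The superoperator `X ↦ -i [B, X]`. -/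
def commutatorPart (B : Matrix n n ℂ) : Matrix n n ℂ →ₗ[ℂ] Matrix n n ℂ where
  toFun X := (-Complex.I) • (B * X - X * B)
  map_add' X Y := by
    rw [← smul_add]; congr 1; noncomm_ring
  map_smul' c X := by
    simp only [mul_smul_comm, smul_mul_assoc, ← smul_sub, RingHom.id_apply,
      smul_comm c (-Complex.I)]

/-- The integral `∫ D(ω) dω` of a superoperator-valued function, taken entrywise in the basis of
matrix units. -/
def integralSuperop (D : ℝ → Matrix n n ℂ →ₗ[ℂ] Matrix n n ℂ) :
    Matrix n n ℂ →ₗ[ℂ] Matrix n n ℂ :=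
  Matrix.toLin (Matrix.stdBasis ℂ n n) (Matrix.stdBasis ℂ n n)
    (Matrix.of fun p q => ∫ ω : ℝ,
      LinearMap.toMatrix (Matrix.stdBasis ℂ n n) (Matrix.stdBasis ℂ n n) (D ω) p q)

/-- The finite set of Bohr frequencies `E_l - E_m` of a Hermitian `H`. -/
def bohrFrequencies {H : Matrix n n ℂ} (hH : H.IsHermitian) : Finset ℝ :=
  Finset.univ.image fun p : n × n => hH.eigenvalues p.1 - hH.eigenvalues p.2

/-- The part `A_ν = ∑_{E_l - E_m = ν} |l⟩⟨l| A |m⟩⟨m|` of `A` with Bohr frequency `ν`, where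
`|l⟩` runs over an orthonormal eigenbasis of `H` (the sum does not depend on its choice). -/
def bohrComponent {H : Matrix n n ℂ} (hH : H.IsHermitian) (A : Matrix n n ℂ) (ν : ℝ) :
    Matrix n n ℂ :=
  (hH.eigenvectorUnitary : Matrix n n ℂ) *
    (Matrix.of fun l m =>
      if hH.eigenvalues l - hH.eigenvalues m = ν then
        ((hH.eigenvectorUnitary : Matrix n n ℂ)ᴴ * A * (hH.eigenvectorUnitary : Matrix n n ℂ)) l m
      else 0) *
    (hH.eigenvectorUnitary : Matrix n n ℂ)ᴴ

/-- The coherent term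
`B = ∑_a ∑_{ν₁, ν₂} tanh(-β (ν₁ - ν₂) / 4) / (2i) · θ(ν₁, ν₂) (A^a_{ν₂})† A^a_{ν₁}`. -/
def coherentTerm {ι : Type*} [Fintype ι] (β σ : ℝ) {H : Matrix n n ℂ} (hH : H.IsHermitian)
    (A : ι → Matrix n n ℂ) : Matrix n n ℂ :=
  ∑ a, ∑ ν₁ ∈ bohrFrequencies hH, ∑ ν₂ ∈ bohrFrequencies hH,
    (((Real.tanh (-β * (ν₁ - ν₂) / 4) : ℝ) : ℂ) / (2 * Complex.I) * (theta β σ ν₁ ν₂ : ℂ)) •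
      ((bohrComponent hH (A a) ν₂)ᴴ * bohrComponent hH (A a) ν₁)

/-- The CKG Lindbladian at inverse temperature `β` and energy resolution `σ`, with Hamiltonian
`H` and jump operators `A a`:
`ℒ[X] = -i[B, X] + ∑_a ∫ γ(ω) (Â^a(ω) X Â^a(ω)† - ½ {Â^a(ω)† Â^a(ω), X}) dω`. -/
def lindbladian {ι : Type*} [Fintype ι] (β σ : ℝ) {H : Matrix n n ℂ} (hH : H.IsHermitian)
    (A : ι → Matrix n n ℂ) : Matrix n n ℂ →ₗ[ℂ] Matrix n n ℂ :=
  commutatorPart (coherentTerm β σ hH A) +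
    ∑ a, integralSuperop fun ω =>
      (metropolis β σ ω : ℂ) • dissipator (oft σ H (A a) ω)

open Classical in
/-- The spectral gap `min_{j > 1} |λ_j|`, where `λ_1 = 0, λ_2, …` are the eigenvalues of the
generator `L` counted with algebraic multiplicity: one copy of the eigenvalue `0` is removed, so
the gap is `0` when `0` is a degenerate eigenvalue. -/
def spectralGap (L : Matrix n n ℂ →ₗ[ℂ] Matrix n n ℂ) : ℝ :=
  sInf {r : ℝ | ∃ z ∈ L.charpoly.roots.erase 0, r = ‖z‖}

end General

/-! ## The hypercube as a system of `d` qubits -/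

/-- Pauli `X`. -/
def pauliX : Matrix (Fin 2) (Fin 2) ℂ := !![0, 1; 1, 0]

/-- Pauli `Z`. -/
def pauliZ : Matrix (Fin 2) (Fin 2) ℂ := !![1, 0; 0, -1]

/-- The operator on `d` qubits that acts as `M` on qubit `a` and as the identity on the others,
in the computational basis of bitstrings. -/
def siteOp {d : ℕ} (M : Matrix (Fin 2) (Fin 2) ℂ) (a : Fin d) :
    Matrix (Fin d → Fin 2) (Fin d → Fin 2) ℂ :=
  Matrix.of fun x y => if ∀ b, b ≠ a → x b = y b then M (x a) (y a) else 0

/-- The hypercube Hamiltonian `H = ∑_i X_i`. -/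
def hypercubeHamiltonian (d : ℕ) : Matrix (Fin d → Fin 2) (Fin d → Fin 2) ℂ :=
  ∑ i : Fin d, siteOp pauliX i

/-- The jump operators `A^a = d^{-1/2} Z_a`. -/
def hypercubeJump (d : ℕ) (a : Fin d) : Matrix (Fin d → Fin 2) (Fin d → Fin 2) ℂ :=
  ((1 / Real.sqrt d : ℝ) : ℂ) • siteOp pauliZ a

theorem hypercubeHamiltonian_isHermitian (d : ℕ) : (hypercubeHamiltonian d).IsHermitian := by
  unfold hypercubeHamiltonian Matrix.IsHermitian
  rw [Matrix.conjTranspose_sum]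
  refine Finset.sum_congr rfl fun a _ => ?_
  ext x y
  simp only [siteOp, Matrix.conjTranspose_apply, Matrix.of_apply]
  have hc : (∀ b, b ≠ a → y b = x b) ↔ (∀ b, b ≠ a → x b = y b) :=
    ⟨fun h b hb => (h b hb).symm, fun h b hb => (h b hb).symm⟩
  simp only [hc]
  split_ifs with h
  · generalize x a = u
    generalize y a = v
    fin_cases u <;> fin_cases v <;> simp [pauliX]
  · simp

/-- The `d`-dimensional hypercube graph: bitstrings joined when their Hamming distance is `1`. -/
def hypercubeGraph (d : ℕ) : SimpleGraph (Fin d → Fin 2) where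
  Adj x y := hammingDist x y = 1
  symm := ⟨fun x y h => by rw [hammingDist_comm]; exact h⟩
  loopless := ⟨fun x h => by simp at h⟩

open Classical in
/-- Consistency check: `∑_i X_i` is the adjacency matrix of the hypercube graph. -/
theorem hypercubeHamiltonian_eq_adjMatrix (d : ℕ) :
    hypercubeHamiltonian d = (hypercubeGraph d).adjMatrix ℂ := by
  ext x y
  rw [SimpleGraph.adjMatrix_apply]
  have hadj : (hypercubeGraph d).Adj x y ↔ hammingDist x y = 1 := Iff.rfl
  simp only [hypercubeHamiltonian, Matrix.sum_apply, siteOp, Matrix.of_apply]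
  have key : ∀ a : Fin d,
      (if ∀ b, b ≠ a → x b = y b then pauliX (x a) (y a) else 0) =
        if ({i | x i ≠ y i} : Finset (Fin d)) = {a} then (1 : ℂ) else 0 := by
    intro a
    have hX : ∀ u v : Fin 2, pauliX u v = if u ≠ v then 1 else 0 := by
      intro u v
      fin_cases u <;> fin_cases v <;> simp [pauliX]
    rw [hX, ← ite_and]
    congr 1
    simp only [Finset.ext_iff, Finset.mem_filter, Finset.mem_univ, true_and,
      Finset.mem_singleton, eq_iff_iff]
    constructor
    · rintro ⟨h1, h2⟩ b
      constructor
      · intro hb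
        by_contra hne
        exact hb (h1 b hne)
      · rintro rfl
        exact h2
    · intro h
      refine ⟨fun b hb => ?_, (h a).2 rfl⟩
      by_contra hne
      exact hb ((h b).1 hne)
  simp only [key, hadj]
  split_ifs with h
  · obtain ⟨a, ha⟩ := Finset.card_eq_one.1 h
    rw [ha]
    simp [Finset.singleton_inj]
  · refine Finset.sum_eq_zero fun a _ => ?_
    rw [if_neg]
    intro ha
    exact h (Finset.card_eq_one.2 ⟨a, ha⟩)

end CKG

end

open scoped Matrix

noncomputable section

namespace CKG

/-! ### Spectral gap read off from an eigenbasis. -/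

section General

variable {n : Type*} [Fintype n] [DecidableEq n]

/-! The qubits do not interact, so the generator splits into commuting one-qubit generators. Since
`[X, |+⟩⟨-|] = 2 |+⟩⟨-|`, each jump operator is a raising part `S` of Bohr frequency `2` plus a
lowering part `T` of Bohr frequency `-2`, and `S† T = T† S = 0`. Hence the coherent term vanishes:
`tanh 0` kills its diagonal terms and orthogonality the others. What remains on each qubit has
pumping rate `p = θ(2,2)`, decay rate `q = θ(-2,-2)` and coherence transfer `k = θ(2,-2)`, all
scaled by `1/d` (`lindbladian_eq_sum`, `hypercube_lindbladian_apply_prodOp`).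

The one-qubit generator is diagonalizable with eigenvalues `0`, `-(p+q)`, `-(p+q)/2 ± k` before
scaling (`qubitGenerator_qubitEigenop`). Products of its eigenoperators form an eigenbasis for `d`
qubits, whose eigenvalues are sums of one-qubit ones divided by `d`. All summands are nonpositive,
so any nonzero index costs at least `((p+q)/2 - |k|)/d`. This constant is positive by strict
Cauchy–Schwarz for the weight `γ`, because the Gaussians centred at `2` and `-2` are not
proportional (`abs_theta_lt`). -/

theorem roots_charpoly_of_eigenbasis {V κ : Type*} [AddCommGroup V] [Module ℂ V] [Fintype κ]
    [DecidableEq κ] [Module.Finite ℂ V] (b : Module.Basis κ ℂ V) (L : V →ₗ[ℂ] V) (μ : κ → ℂ)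
    (h : ∀ j, L (b j) = μ j • b j) : L.charpoly.roots = Finset.univ.val.map μ := by
  have hM : LinearMap.toMatrix b b L = Matrix.diagonal μ := by
    ext i j
    rw [LinearMap.toMatrix_apply, h, map_smul, Module.Basis.repr_self, Matrix.diagonal_apply]
    by_cases hij : i = j <;> simp [hij]
  rw [← LinearMap.charpoly_toMatrix L b, hM, Matrix.charpoly_diagonal, Polynomial.roots_prod]
  · simp
  · simp [Finset.prod_ne_zero_iff, Polynomial.X_sub_C_ne_zero]

omit [DecidableEq n] in
/-- If `L` has an eigenbasis with one eigenvalue `0` and all other eigenvalues of modulus at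
least `g`, its spectral gap is at least `g`. -/
theorem le_spectralGap_of_eigenbasis {κ : Type*} [Fintype κ] [Nontrivial κ]
    (b : Module.Basis κ ℂ (Matrix n n ℂ)) (L : Matrix n n ℂ →ₗ[ℂ] Matrix n n ℂ) (μ : κ → ℂ)
    (h : ∀ j, L (b j) = μ j • b j) (j₀ : κ) (h₀ : μ j₀ = 0) (g : ℝ)
    (hg : ∀ j, j ≠ j₀ → g ≤ ‖μ j‖) : g ≤ spectralGap L := by
  classical
  have hroots : L.charpoly.roots.erase 0 = (Finset.univ.erase j₀).val.map μ := by
    rw [roots_charpoly_of_eigenbasis b L μ h, Finset.erase_val,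
      ← Multiset.cons_erase (Finset.mem_univ_val j₀), Multiset.map_cons, h₀,
      Multiset.erase_cons_head, Multiset.erase_cons_head]
  -- `sInf ∅ = 0` in `ℝ`, so the bound needs a second eigenvalue to exist.
  obtain ⟨j₁, hj₁⟩ := exists_ne j₀
  unfold spectralGap
  apply le_csInf
  · refine ⟨‖μ j₁‖, μ j₁, ?_, rfl⟩
    have hmem : μ j₁ ∈ L.charpoly.roots.erase 0 := by
      rw [hroots]
      exact Multiset.mem_map_of_mem μ (show j₁ ∈ (Finset.univ.erase j₀).val from
        Finset.mem_erase.2 ⟨hj₁, Finset.mem_univ _⟩)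
    convert hmem
  · rintro r ⟨z, hz, rfl⟩
    have hz' : z ∈ (Finset.univ.erase j₀).val.map μ := by
      rw [← hroots]
      convert hz
    obtain ⟨j, hj, rfl⟩ := Multiset.mem_map.1 hz'
    exact hg j (Finset.ne_of_mem_erase (Finset.mem_def.2 hj))

/-! ### Operators that shift the energy by a fixed amount. -/

section Spectral

variable {H : Matrix n n ℂ} (hH : H.IsHermitian)

theorem conjTranspose_eigenvectorUnitary_mul :
    (hH.eigenvectorUnitary : Matrix n n ℂ)ᴴ * (hH.eigenvectorUnitary : Matrix n n ℂ) = 1 :=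
  Unitary.coe_star_mul_self hH.eigenvectorUnitary

theorem eigenvectorUnitary_mul_conjTranspose :
    (hH.eigenvectorUnitary : Matrix n n ℂ) * (hH.eigenvectorUnitary : Matrix n n ℂ)ᴴ = 1 :=
  Unitary.coe_mul_star_self hH.eigenvectorUnitary

theorem eq_eigenvectorUnitary_mul_diagonal :
    H = (hH.eigenvectorUnitary : Matrix n n ℂ) *
      Matrix.diagonal (fun l => (hH.eigenvalues l : ℂ)) *
        (hH.eigenvectorUnitary : Matrix n n ℂ)ᴴ := by
  conv_lhs => rw [hH.spectral_theorem]
  rfl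

theorem eq_conj_of_eigenvectorUnitary (S : Matrix n n ℂ) :
    S = (hH.eigenvectorUnitary : Matrix n n ℂ) *
      ((hH.eigenvectorUnitary : Matrix n n ℂ)ᴴ * S * (hH.eigenvectorUnitary : Matrix n n ℂ)) *
        (hH.eigenvectorUnitary : Matrix n n ℂ)ᴴ := by
  have h := eigenvectorUnitary_mul_conjTranspose hH
  set U := (hH.eigenvectorUnitary : Matrix n n ℂ)
  calc S = (U * Uᴴ) * S * (U * Uᴴ) := by rw [h]; simp
    _ = _ := by simp only [mul_assoc]

/-- In an eigenbasis of `H`, an operator with `[H, S] = ν S` only connects levels at energy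
difference `ν`. -/
theorem eigenbasis_apply_eq_zero {S : Matrix n n ℂ} {ν : ℝ} (h : H * S - S * H = (ν : ℂ) • S)
    {l m : n} (hlm : hH.eigenvalues l - hH.eigenvalues m ≠ ν) :
    ((hH.eigenvectorUnitary : Matrix n n ℂ)ᴴ * S *
      (hH.eigenvectorUnitary : Matrix n n ℂ)) l m = 0 := by
  have hU := conjTranspose_eigenvectorUnitary_mul hH
  have hD := eq_eigenvectorUnitary_mul_diagonal hH
  set U := (hH.eigenvectorUnitary : Matrix n n ℂ)
  set D := Matrix.diagonal (fun l => (hH.eigenvalues l : ℂ)) with hDdef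
  have h1 : Uᴴ * H = D * Uᴴ := by
    conv_lhs => rw [hD, ← mul_assoc, ← mul_assoc, hU, one_mul]
  have h2 : H * U = U * D := by
    conv_lhs => rw [hD, mul_assoc, hU, mul_one]
  have h3 : D * (Uᴴ * S * U) - (Uᴴ * S * U) * D = (ν : ℂ) • (Uᴴ * S * U) := by
    calc D * (Uᴴ * S * U) - (Uᴴ * S * U) * D
        = (D * Uᴴ) * S * U - Uᴴ * S * (U * D) := by simp only [mul_assoc]
      _ = Uᴴ * (H * S - S * H) * U := by
        rw [← h1, ← h2]; simp only [mul_assoc, mul_sub, sub_mul]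
      _ = _ := by rw [h]; simp only [Matrix.mul_smul, Matrix.smul_mul]
  have h4 := congrFun (congrFun h3 l) m
  rw [Matrix.sub_apply, hDdef, Matrix.diagonal_mul, Matrix.mul_diagonal, Matrix.smul_apply,
    smul_eq_mul] at h4
  have h5 : (((hH.eigenvalues l - hH.eigenvalues m - ν : ℝ)) : ℂ) * (Uᴴ * S * U) l m = 0 := by
    push_cast
    linear_combination h4
  rcases mul_eq_zero.1 h5 with h6 | h6
  · exact absurd (by exact_mod_cast h6) (sub_ne_zero.2 hlm)
  · exact h6

theorem bohrComponent_add (A A' : Matrix n n ℂ) (ν : ℝ) :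
    bohrComponent hH (A + A') ν = bohrComponent hH A ν + bohrComponent hH A' ν := by
  unfold bohrComponent
  rw [← add_mul, ← mul_add]
  congr 2
  ext l m
  simp only [Matrix.add_apply, Matrix.of_apply, mul_add, add_mul]
  split_ifs <;> simp

/-- The commutator relation replaces any knowledge of the eigenbasis hidden in `eigenvectorUnitary`.
-/
theorem bohrComponent_of_commutator {S : Matrix n n ℂ} {ν : ℝ}
    (h : H * S - S * H = (ν : ℂ) • S) (ω : ℝ) :
    bohrComponent hH S ω = if ω = ν then S else 0 := by
  have hz := fun l m => eigenbasis_apply_eq_zero hH h (l := l) (m := m)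
  unfold bohrComponent
  split_ifs with hω
  · subst hω
    conv_rhs => rw [eq_conj_of_eigenvectorUnitary hH S]
    congr 2
    ext l m
    rw [Matrix.of_apply]
    split_ifs with hlm
    · rfl
    · exact (hz l m hlm).symm
  · have h0 : (Matrix.of fun l m => if hH.eigenvalues l - hH.eigenvalues m = ω then
        ((hH.eigenvectorUnitary : Matrix n n ℂ)ᴴ * S *
          (hH.eigenvectorUnitary : Matrix n n ℂ)) l m else 0) = 0 := by
      ext l m
      rw [Matrix.of_apply, Matrix.zero_apply]
      split_ifs with hlm
      · exact hz l m (by rw [hlm]; exact hω)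
      · rfl
    rw [h0, mul_zero, zero_mul]

theorem exp_smul_eq (c : ℂ) :
    NormedSpace.exp (c • H) = (hH.eigenvectorUnitary : Matrix n n ℂ) *
      Matrix.diagonal (fun l => Complex.exp (c * hH.eigenvalues l)) *
        (hH.eigenvectorUnitary : Matrix n n ℂ)ᴴ := by
  have hU := eigenvectorUnitary_mul_conjTranspose hH
  have hD := eq_eigenvectorUnitary_mul_diagonal hH
  have hunit : IsUnit (hH.eigenvectorUnitary : Matrix n n ℂ) :=
    (Unitary.toUnits hH.eigenvectorUnitary).isUnit
  set U := (hH.eigenvectorUnitary : Matrix n n ℂ)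
  have hinv : U⁻¹ = Uᴴ := Matrix.inv_eq_right_inv hU
  have h1 : c • H = U * Matrix.diagonal (fun l => c * (hH.eigenvalues l : ℂ)) * U⁻¹ := by
    conv_lhs => rw [hD]
    rw [hinv, ← Matrix.smul_mul, ← Matrix.mul_smul, ← Matrix.diagonal_smul]
    rfl
  rw [h1, Matrix.exp_conj _ _ hunit, Matrix.exp_diagonal, hinv]
  congr 3
  ext l
  rw [Pi.coe_exp, Complex.exp_eq_exp_ℂ]

/-- In the eigenbasis the `(l, m)` entry acquires the phase `e^{it(E_l - E_m)}`, and every nonzero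
entry has `E_l - E_m = ν`. -/
theorem heisenberg_of_commutator {H : Matrix n n ℂ} (hH : H.IsHermitian) {S : Matrix n n ℂ} {ν : ℝ}
    (h : H * S - S * H = (ν : ℂ) • S) (t : ℝ) :
    heisenberg H S t = Complex.exp (Complex.I * ν * t) • S := by
  unfold heisenberg
  rw [exp_smul_eq hH, exp_smul_eq hH]
  have hz := fun l m => eigenbasis_apply_eq_zero hH h (l := l) (m := m)
  conv_rhs => rw [eq_conj_of_eigenvectorUnitary hH S]
  set U := (hH.eigenvectorUnitary : Matrix n n ℂ)
  set M := Uᴴ * S * U with hM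
  have key : Matrix.diagonal (fun l => Complex.exp (Complex.I * t * hH.eigenvalues l)) * M *
      Matrix.diagonal (fun l => Complex.exp (-(Complex.I * t) * hH.eigenvalues l)) =
      Complex.exp (Complex.I * ν * t) • M := by
    ext l m
    rw [Matrix.mul_diagonal, Matrix.diagonal_mul, Matrix.smul_apply, smul_eq_mul]
    by_cases hlm : hH.eigenvalues l - hH.eigenvalues m = ν
    · rw [mul_right_comm, ← Complex.exp_add, ← hlm]
      congr 2
      push_cast
      ring
    · rw [hz l m hlm]
      simp
  rw [← Matrix.smul_mul, ← Matrix.mul_smul, ← key, hM]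
  simp only [mul_assoc]

theorem heisenberg_add (A A' : Matrix n n ℂ) (t : ℝ) :
    heisenberg H (A + A') t = heisenberg H A t + heisenberg H A' t := by
  unfold heisenberg
  rw [mul_add, add_mul]

end Spectral

/-! ### Gaussian filters and the operator Fourier transform. -/

theorem filter_integrand_eq (σ ν ω t : ℝ) :
    Complex.exp (Complex.I * ν * t) * Complex.exp (-(Complex.I * (ω : ℂ) * (t : ℂ))) *
        (timeFilter σ t : ℂ) =
      (Real.sqrt (σ * Real.sqrt (2 / Real.pi)) : ℂ) *
        (Complex.exp (Complex.I * ((ν - ω : ℝ) : ℂ) * t) *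
          Complex.exp (-((σ ^ 2 : ℝ) : ℂ) * t ^ 2)) := by
  unfold timeFilter
  push_cast
  rw [← Complex.exp_add, ← Complex.exp_add, ← mul_assoc, ← Complex.exp_add, mul_comm]
  congr 2
  ring

theorem integrable_filter_integrand {σ : ℝ} (hσ : 0 < σ) (ν ω : ℝ) :
    MeasureTheory.Integrable fun t : ℝ =>
      Complex.exp (Complex.I * ν * t) * Complex.exp (-(Complex.I * (ω : ℂ) * (t : ℂ))) *
        (timeFilter σ t : ℂ) := by
  simp only [filter_integrand_eq]
  apply MeasureTheory.Integrable.const_mul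
  have := integrable_cexp_quadratic (b := ((σ ^ 2 : ℝ) : ℂ))
    (by rw [Complex.ofReal_re]; positivity) (Complex.I * ((ν - ω : ℝ) : ℂ)) 0
  refine this.congr (Filter.Eventually.of_forall fun t => ?_)
  simp only [← Complex.exp_add]
  congr 1
  ring

theorem filter_normalization {σ : ℝ} (hσ : 0 < σ) :
    1 / Real.sqrt (2 * Real.pi) * (Real.sqrt (σ * Real.sqrt (2 / Real.pi)) *
      Real.sqrt (Real.pi / σ ^ 2)) = 1 / Real.sqrt (σ * Real.sqrt (2 * Real.pi)) := by
  have hπ := Real.pi_pos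
  have hs : 0 < Real.sqrt (2 * Real.pi) := by positivity
  have hs2 : Real.sqrt (2 * Real.pi) ^ 2 = 2 * Real.pi := Real.sq_sqrt (by positivity)
  have h2 : Real.sqrt (2 / Real.pi) = 2 / Real.sqrt (2 * Real.pi) := by
    rw [Real.sqrt_eq_iff_mul_self_eq_of_pos (by positivity), div_mul_div_comm,
      Real.mul_self_sqrt (by positivity)]
    field_simp
  rw [← sq_eq_sq₀ (by positivity) (by positivity), mul_pow, mul_pow, div_pow, div_pow,
    Real.sq_sqrt (by positivity), Real.sq_sqrt (by positivity), Real.sq_sqrt (by positivity),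
    Real.sq_sqrt (by positivity), h2]
  field_simp

theorem integral_filter_integrand {σ : ℝ} (hσ : 0 < σ) (ν ω : ℝ) :
    ((1 / Real.sqrt (2 * Real.pi) : ℝ) : ℂ) * ∫ t : ℝ,
      Complex.exp (Complex.I * ν * t) * Complex.exp (-(Complex.I * (ω : ℂ) * (t : ℂ))) *
        (timeFilter σ t : ℂ) = (freqFilter σ (ω - ν) : ℂ) := by
  simp only [filter_integrand_eq]
  rw [MeasureTheory.integral_const_mul,
    fourierIntegral_gaussian (by rw [Complex.ofReal_re]; positivity)]
  have h1 : ((Real.pi : ℂ) / ((σ ^ 2 : ℝ) : ℂ)) ^ (1 / 2 : ℂ) =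
      ((Real.sqrt (Real.pi / σ ^ 2) : ℝ) : ℂ) := by
    rw [Real.sqrt_eq_rpow, Complex.ofReal_cpow (by positivity)]
    push_cast
    rfl
  rw [h1, freqFilter, ← filter_normalization hσ]
  push_cast
  have h2 : -((ν : ℂ) - ω) ^ 2 = -(ω - ν) ^ 2 := by ring
  rw [h2]
  ring

theorem oft_of_commutator_add {σ : ℝ} (hσ : 0 < σ) {H : Matrix n n ℂ} (hH : H.IsHermitian)
    {S T : Matrix n n ℂ} {ν μ : ℝ} (hS : H * S - S * H = (ν : ℂ) • S)
    (hT : H * T - T * H = (μ : ℂ) • T) (ω : ℝ) :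
    oft σ H (S + T) ω =
      (freqFilter σ (ω - ν) : ℂ) • S + (freqFilter σ (ω - μ) : ℂ) • T := by
  ext i j
  have hpt : ∀ t : ℝ, heisenberg H (S + T) t i j *
      Complex.exp (-(Complex.I * (ω : ℂ) * (t : ℂ))) * (timeFilter σ t : ℂ) =
      Complex.exp (Complex.I * ν * t) * Complex.exp (-(Complex.I * (ω : ℂ) * (t : ℂ))) *
        (timeFilter σ t : ℂ) * S i j +
      Complex.exp (Complex.I * μ * t) * Complex.exp (-(Complex.I * (ω : ℂ) * (t : ℂ))) *
        (timeFilter σ t : ℂ) * T i j := by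
    intro t
    rw [heisenberg_add, heisenberg_of_commutator hH hS, heisenberg_of_commutator hH hT]
    simp only [Matrix.add_apply, Matrix.smul_apply, smul_eq_mul]
    ring
  simp only [oft, Matrix.of_apply, hpt]
  rw [MeasureTheory.integral_add ((integrable_filter_integrand hσ ν ω).mul_const _)
    ((integrable_filter_integrand hσ μ ω).mul_const _), MeasureTheory.integral_mul_const,
    MeasureTheory.integral_mul_const, mul_add, ← mul_assoc, ← mul_assoc,
    integral_filter_integrand hσ, integral_filter_integrand hσ]
  rfl

/-- The dissipative integrand is a combination of three fixed superoperators with scalar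
coefficients depending on `ω`, so only scalar integrals remain. -/
theorem integralSuperop_sum_smul {κ : Type*} [Fintype κ] (c : κ → ℝ → ℝ)
    (hc : ∀ k, MeasureTheory.Integrable (c k)) (T : κ → Matrix n n ℂ →ₗ[ℂ] Matrix n n ℂ) :
    integralSuperop (fun ω => ∑ k, (c k ω : ℂ) • T k) =
      ∑ k, ((∫ ω, c k ω : ℝ) : ℂ) • T k := by
  unfold integralSuperop
  rw [← LinearEquiv.eq_symm_apply, Matrix.toLin_symm]
  ext p q
  simp only [Matrix.of_apply, map_sum, map_smul, Matrix.sum_apply, Matrix.smul_apply,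
    smul_eq_mul]
  rw [MeasureTheory.integral_finsetSum _ fun k _ => (hc k).ofReal.mul_const _]
  refine Finset.sum_congr rfl fun k _ => ?_
  rw [MeasureTheory.integral_mul_const]
  exact congrArg (· * _) integral_ofReal

/-! ### Positivity of the kernel `theta`. -/

theorem metropolis_pos (β σ ω : ℝ) : 0 < metropolis β σ ω := Real.exp_pos _

theorem continuous_metropolis (β σ : ℝ) : Continuous (metropolis β σ) := by
  unfold metropolis
  fun_prop

theorem metropolis_le_one {β : ℝ} (hβ : 0 ≤ β) (σ ω : ℝ) : metropolis β σ ω ≤ 1 := by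
  unfold metropolis
  rw [Real.exp_le_one_iff]
  have := mul_nonneg hβ (le_max_right (ω + β * σ ^ 2 / 2) 0)
  linarith

theorem freqFilter_pos {σ : ℝ} (hσ : 0 < σ) (ω : ℝ) : 0 < freqFilter σ ω := by
  unfold freqFilter
  positivity

theorem freqFilter_le (σ ω : ℝ) :
    freqFilter σ ω ≤ 1 / Real.sqrt (σ * Real.sqrt (2 * Real.pi)) := by
  unfold freqFilter
  refine mul_le_of_le_one_right (by positivity) ?_
  rw [Real.exp_le_one_iff, neg_div]
  exact neg_nonpos.2 (by positivity)

theorem continuous_freqFilter (σ : ℝ) : Continuous (freqFilter σ) := by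
  unfold freqFilter
  fun_prop

theorem integrable_freqFilter {σ : ℝ} (hσ : 0 < σ) : MeasureTheory.Integrable (freqFilter σ) := by
  unfold freqFilter
  refine ((integrable_exp_neg_mul_sq (b := 1 / (4 * σ ^ 2)) (by positivity)).const_mul
    (1 / Real.sqrt (σ * Real.sqrt (2 * Real.pi)))).congr
    (Filter.Eventually.of_forall fun ω => ?_)
  simp only
  congr 2
  ring

theorem integrable_theta_integrand {β σ : ℝ} (hβ : 0 ≤ β) (hσ : 0 < σ) (ν₁ ν₂ : ℝ) :
    MeasureTheory.Integrable fun ω : ℝ =>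
      freqFilter σ (ω - ν₁) * freqFilter σ (ω - ν₂) * metropolis β σ ω := by
  have hcf := continuous_freqFilter σ
  have hcm := continuous_metropolis β σ
  have hc : Continuous fun ω : ℝ =>
      freqFilter σ (ω - ν₁) * freqFilter σ (ω - ν₂) * metropolis β σ ω := by fun_prop
  refine (((integrable_freqFilter hσ).comp_sub_right ν₁).mul_const
    (1 / Real.sqrt (σ * Real.sqrt (2 * Real.pi)))).mono'
    hc.aestronglyMeasurable (Filter.Eventually.of_forall fun ω => ?_)
  have h1 := freqFilter_pos hσ (ω - ν₁)
  have h2 := freqFilter_pos hσ (ω - ν₂)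
  have h3 := metropolis_pos β σ ω
  rw [Real.norm_of_nonneg (by positivity)]
  calc _ ≤ freqFilter σ (ω - ν₁) * freqFilter σ (ω - ν₂) * 1 := by
        gcongr
        exact metropolis_le_one hβ σ ω
    _ ≤ _ := by
        rw [mul_one]
        gcongr
        exact freqFilter_le _ _

/-- The quadratic form of `theta` is positive where the combined filter does not vanish. -/
theorem theta_quadratic_pos {β σ : ℝ} (hβ : 0 ≤ β) (hσ : 0 < σ) (ν₁ ν₂ s : ℝ)
    (hne : ∃ ω, freqFilter σ (ω - ν₁) + s * freqFilter σ (ω - ν₂) ≠ 0) :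
    0 < theta β σ ν₁ ν₁ + s ^ 2 * theta β σ ν₂ ν₂ + 2 * s * theta β σ ν₁ ν₂ := by
  have i11 := integrable_theta_integrand hβ hσ ν₁ ν₁
  have i22 := (integrable_theta_integrand hβ hσ ν₂ ν₂).const_mul (s ^ 2)
  have i12 := (integrable_theta_integrand hβ hσ ν₁ ν₂).const_mul (2 * s)
  have heq : (fun ω => freqFilter σ (ω - ν₁) * freqFilter σ (ω - ν₁) * metropolis β σ ω +
      s ^ 2 * (freqFilter σ (ω - ν₂) * freqFilter σ (ω - ν₂) * metropolis β σ ω) +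
      2 * s * (freqFilter σ (ω - ν₁) * freqFilter σ (ω - ν₂) * metropolis β σ ω)) =
      fun ω => (freqFilter σ (ω - ν₁) + s * freqFilter σ (ω - ν₂)) ^ 2 * metropolis β σ ω := by
    ext ω; ring
  have hint : MeasureTheory.Integrable fun ω =>
      (freqFilter σ (ω - ν₁) + s * freqFilter σ (ω - ν₂)) ^ 2 * metropolis β σ ω := by
    rw [← heq]
    exact (i11.add i22).add i12
  have hval : theta β σ ν₁ ν₁ + s ^ 2 * theta β σ ν₂ ν₂ + 2 * s * theta β σ ν₁ ν₂ =
      ∫ ω, (freqFilter σ (ω - ν₁) + s * freqFilter σ (ω - ν₂)) ^ 2 * metropolis β σ ω := by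
    unfold theta
    rw [← heq, ← MeasureTheory.integral_const_mul, ← MeasureTheory.integral_const_mul,
      ← MeasureTheory.integral_add i11 i22]
    exact (MeasureTheory.integral_add (i11.add i22) i12).symm
  obtain ⟨ω₀, hω₀⟩ := hne
  have hcf := continuous_freqFilter σ
  have hcm := continuous_metropolis β σ
  rw [hval]
  refine MeasureTheory.integral_pos_of_integrable_nonneg_nonzero (x := ω₀) (by fun_prop)
    hint (fun ω => ?_) (mul_ne_zero (pow_ne_zero _ hω₀) (metropolis_pos β σ ω₀).ne')
  have := metropolis_pos β σ ω
  simp only [Pi.zero_apply]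
  positivity

/-- The quadratic form at `s = 1` and `s = -1` bounds `theta β σ ν (-ν)` from below and above. -/
theorem abs_theta_lt {β σ ν : ℝ} (hβ : 0 ≤ β) (hσ : 0 < σ) (hν : ν ≠ 0) :
    |theta β σ ν (-ν)| < (theta β σ ν ν + theta β σ (-ν) (-ν)) / 2 := by
  have hp := theta_quadratic_pos (β := β) hβ hσ ν (-ν) 1 ⟨0, by
    have h1 := freqFilter_pos hσ (0 - ν)
    have h2 := freqFilter_pos hσ (0 - -ν)
    positivity⟩
  -- At `ω = ν` the first Gaussian is at its peak and the second, centred at `-ν ≠ ν`, is strictly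
  -- below it.
  have hm := theta_quadratic_pos (β := β) hβ hσ ν (-ν) (-1) ⟨ν, by
    have hlt : freqFilter σ (ν - -ν) < freqFilter σ (ν - ν) := by
      unfold freqFilter
      refine mul_lt_mul_of_pos_left ?_ (by positivity)
      rw [Real.exp_lt_exp, sub_self, neg_div]
      have : 0 < (ν - -ν) ^ 2 / (4 * σ ^ 2) := by
        have : ν - -ν ≠ 0 := by
          rw [sub_neg_eq_add, ← two_mul]
          exact mul_ne_zero two_ne_zero hν
        positivity
      simpa using this
    intro h
    linarith⟩
  rw [abs_lt]
  constructor <;> linarith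

/-! ### The generator for jump operators with two Bohr frequencies. -/

/-- The superoperator `X ↦ K X L† + L X K†`. -/
def crossTerm (K L : Matrix n n ℂ) : Matrix n n ℂ →ₗ[ℂ] Matrix n n ℂ where
  toFun X := K * X * Lᴴ + L * X * Kᴴ
  map_add' X Y := by
    simp only [mul_add, add_mul]; abel
  map_smul' c X := by
    simp only [mul_smul_comm, smul_mul_assoc, smul_add, RingHom.id_apply]

theorem dissipator_apply (K X : Matrix n n ℂ) :
    dissipator K X = K * X * Kᴴ - (1 / 2 : ℂ) • (Kᴴ * K * X + X * (Kᴴ * K)) := rfl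

theorem crossTerm_apply (K L X : Matrix n n ℂ) :
    crossTerm K L X = K * X * Lᴴ + L * X * Kᴴ := rfl

/-- Orthogonality removes the mixed terms of `K† K`; they survive only in `K X K†`, where they form
`crossTerm`. -/
theorem dissipator_smul_add_smul {S T : Matrix n n ℂ} (hST : Sᴴ * T = 0) (hTS : Tᴴ * S = 0)
    (p q : ℝ) :
    dissipator ((p : ℂ) • S + (q : ℂ) • T) =
      ((p * p : ℝ) : ℂ) • dissipator S + ((q * q : ℝ) : ℂ) • dissipator T +
        ((p * q : ℝ) : ℂ) • crossTerm S T := by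
  have hKK : ((p : ℂ) • S + (q : ℂ) • T)ᴴ * ((p : ℂ) • S + (q : ℂ) • T) =
      ((p * p : ℝ) : ℂ) • (Sᴴ * S) + ((q * q : ℝ) : ℂ) • (Tᴴ * T) := by
    simp only [Matrix.conjTranspose_add, Matrix.conjTranspose_smul, add_mul, mul_add,
      Matrix.smul_mul, Matrix.mul_smul, hST, hTS, smul_zero, smul_smul]
    simp
  refine LinearMap.ext fun X => ?_
  simp only [LinearMap.add_apply, LinearMap.smul_apply, dissipator_apply, crossTerm_apply, hKK]
  simp only [Matrix.conjTranspose_add, Matrix.conjTranspose_smul, add_mul, mul_add,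
    Matrix.smul_mul, Matrix.mul_smul, Complex.star_def, Complex.conj_ofReal, smul_add, smul_sub,
    smul_smul, Complex.ofReal_mul]
  module

section TwoFrequencies

variable {ι : Type*} [Fintype ι] {β σ ν μ : ℝ} {H : Matrix n n ℂ} (hH : H.IsHermitian)
  {S T : ι → Matrix n n ℂ} (hS : ∀ a, H * S a - S a * H = (ν : ℂ) • S a)
  (hT : ∀ a, H * T a - T a * H = (μ : ℂ) • T a)
  (hST : ∀ a, (S a)ᴴ * T a = 0) (hTS : ∀ a, (T a)ᴴ * S a = 0)

include hS hT hST hTS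

theorem coherentTerm_eq_zero : coherentTerm β σ hH (fun a => S a + T a) = 0 := by
  unfold coherentTerm
  refine Finset.sum_eq_zero fun a _ => Finset.sum_eq_zero fun ν₁ _ =>
    Finset.sum_eq_zero fun ν₂ _ => ?_
  rw [bohrComponent_add, bohrComponent_add, bohrComponent_of_commutator hH (hS a),
    bohrComponent_of_commutator hH (hT a), bohrComponent_of_commutator hH (hS a),
    bohrComponent_of_commutator hH (hT a)]
  -- Equal frequencies give `tanh 0 = 0`; distinct ones leave only products `S† T` or `T† S`.
  by_cases h12 : ν₁ = ν₂
  · simp [h12]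
  · have hprod : ((if ν₂ = ν then S a else 0) + (if ν₂ = μ then T a else 0))ᴴ *
        ((if ν₁ = ν then S a else 0) + (if ν₁ = μ then T a else 0)) = 0 := by
      split_ifs <;> simp_all
    rw [hprod, smul_zero]

/-- The CKG Lindbladian when every jump operator is a sum of two components with frequencies
`ν`, `μ` and orthogonal ranges. -/
theorem lindbladian_eq_sum (hβ : 0 ≤ β) (hσ : 0 < σ) :
    lindbladian β σ hH (fun a => S a + T a) =
      ∑ a, ((theta β σ ν ν : ℂ) • dissipator (S a) + (theta β σ μ μ : ℂ) • dissipator (T a) +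
        (theta β σ ν μ : ℂ) • crossTerm (S a) (T a)) := by
  have hcomm : commutatorPart (0 : Matrix n n ℂ) = 0 := by
    refine LinearMap.ext fun X => ?_
    simp [commutatorPart]
  unfold lindbladian
  rw [coherentTerm_eq_zero hH hS hT hST hTS, hcomm, zero_add]
  refine Finset.sum_congr rfl fun a _ => ?_
  have hfun : (fun ω => (metropolis β σ ω : ℂ) • dissipator (oft σ H (S a + T a) ω)) =
      fun ω => ∑ k : Fin 3, ((![fun ω => freqFilter σ (ω - ν) * freqFilter σ (ω - ν) *
          metropolis β σ ω, fun ω => freqFilter σ (ω - μ) * freqFilter σ (ω - μ) *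
          metropolis β σ ω, fun ω => freqFilter σ (ω - ν) * freqFilter σ (ω - μ) *
          metropolis β σ ω] k ω : ℝ) : ℂ) •
        ![dissipator (S a), dissipator (T a), crossTerm (S a) (T a)] k := by
    funext ω
    rw [oft_of_commutator_add hσ hH (hS a) (hT a), dissipator_smul_add_smul (hST a) (hTS a),
      Fin.sum_univ_three]
    simp only [Matrix.cons_val, smul_add, smul_smul, ← Complex.ofReal_mul,
      mul_comm (metropolis β σ ω)]
  rw [hfun, integralSuperop_sum_smul, Fin.sum_univ_three]
  · simp only [Matrix.cons_val]
    rfl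
  · intro k
    fin_cases k <;> exact integrable_theta_integrand hβ hσ _ _

end TwoFrequencies

end General

/-! ### Product operators and one-site superoperators. -/

section Hypercube

variable {d : ℕ}

/-- The product operator `⨂_a u_a` on `d` qubits. -/
def prodOp (u : Fin d → Matrix (Fin 2) (Fin 2) ℂ) :
    Matrix (Fin d → Fin 2) (Fin d → Fin 2) ℂ :=
  Matrix.of fun x y => ∏ a, u a (x a) (y a)

theorem prodOp_mul (u v : Fin d → Matrix (Fin 2) (Fin 2) ℂ) :
    prodOp u * prodOp v = prodOp fun a => u a * v a := by
  ext x y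
  simp only [prodOp, Matrix.mul_apply, Matrix.of_apply]
  rw [Finset.prod_univ_sum, Fintype.piFinset_univ]
  exact Finset.sum_congr rfl fun z _ => Finset.prod_mul_distrib.symm

/-- The bilinear pairing, without conjugation, factorizes over sites; this lifts one-qubit dual
bases to `d` qubits. -/
theorem sum_prodOp_mul_prodOp (w u : Fin d → Matrix (Fin 2) (Fin 2) ℂ) :
    ∑ x, ∑ y, prodOp w x y * prodOp u x y = ∏ a, ∑ p, ∑ q, w a p q * u a p q := by
  simp only [prodOp, Matrix.of_apply]
  rw [Finset.prod_univ_sum, Fintype.piFinset_univ]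
  refine Finset.sum_congr rfl fun x _ => ?_
  rw [Finset.prod_univ_sum, Fintype.piFinset_univ]
  exact Finset.sum_congr rfl fun y _ => Finset.prod_mul_distrib.symm

theorem prodOp_update_apply (u : Fin d → Matrix (Fin 2) (Fin 2) ℂ) (a : Fin d)
    (M : Matrix (Fin 2) (Fin 2) ℂ) (x y : Fin d → Fin 2) :
    prodOp (Function.update u a M) x y =
      M (x a) (y a) * ∏ b ∈ Finset.univ.erase a, u b (x b) (y b) := by
  rw [prodOp, Matrix.of_apply, ← Finset.mul_prod_erase _ _ (Finset.mem_univ a),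
    Function.update_self]
  congr 1
  refine Finset.prod_congr rfl fun b hb => ?_
  rw [Function.update_of_ne (Finset.ne_of_mem_erase hb)]

/-- The operator with factor `M` on qubit `a` and factors `u_b` on the others, linear in `M`. -/
def insertOp (a : Fin d) (u : Fin d → Matrix (Fin 2) (Fin 2) ℂ) :
    Matrix (Fin 2) (Fin 2) ℂ →ₗ[ℂ] Matrix (Fin d → Fin 2) (Fin d → Fin 2) ℂ where
  toFun M := prodOp (Function.update u a M)
  map_add' M N := by
    ext x y
    simp only [prodOp_update_apply, Matrix.add_apply, add_mul]
  map_smul' c M := by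
    ext x y
    simp only [prodOp_update_apply, Matrix.smul_apply, smul_eq_mul, mul_assoc, RingHom.id_apply]

theorem insertOp_self (a : Fin d) (u : Fin d → Matrix (Fin 2) (Fin 2) ℂ) :
    insertOp a u (u a) = prodOp u :=
  congrArg prodOp (Function.update_eq_self a u)

theorem insertOp_mul (a : Fin d) (u v : Fin d → Matrix (Fin 2) (Fin 2) ℂ)
    (M N : Matrix (Fin 2) (Fin 2) ℂ) :
    insertOp a u M * insertOp a v N = insertOp a (fun b => u b * v b) (M * N) := by
  refine (prodOp_mul _ _).trans (congrArg prodOp (funext fun b => ?_))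
  by_cases hb : b = a
  · subst hb; simp
  · simp [hb]

theorem siteOp_eq_insertOp (M : Matrix (Fin 2) (Fin 2) ℂ) (a : Fin d) :
    siteOp M a = insertOp a (fun _ => 1) M := by
  ext x y
  refine Eq.trans ?_ (prodOp_update_apply _ _ _ _ _).symm
  simp only [siteOp, Matrix.of_apply, Matrix.one_apply]
  split_ifs with h
  · rw [Finset.prod_eq_one, mul_one]
    exact fun b hb => if_pos (h b (Finset.ne_of_mem_erase hb))
  · push Not at h
    obtain ⟨b, hb, hxy⟩ := h
    rw [Finset.prod_eq_zero (Finset.mem_erase.2 ⟨hb, Finset.mem_univ b⟩) (if_neg hxy), mul_zero]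

theorem siteOp_mul_insertOp (S M : Matrix (Fin 2) (Fin 2) ℂ) (a : Fin d)
    (u : Fin d → Matrix (Fin 2) (Fin 2) ℂ) :
    siteOp S a * insertOp a u M = insertOp a u (S * M) := by
  simp only [siteOp_eq_insertOp, insertOp_mul, one_mul]

theorem insertOp_mul_siteOp (S M : Matrix (Fin 2) (Fin 2) ℂ) (a : Fin d)
    (u : Fin d → Matrix (Fin 2) (Fin 2) ℂ) :
    insertOp a u M * siteOp S a = insertOp a u (M * S) := by
  simp only [siteOp_eq_insertOp, insertOp_mul, mul_one]

theorem siteOp_mul (M N : Matrix (Fin 2) (Fin 2) ℂ) (a : Fin d) :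
    siteOp M a * siteOp N a = siteOp (M * N) a := by
  simp only [siteOp_eq_insertOp, insertOp_mul, mul_one]

theorem siteOp_commute (M N : Matrix (Fin 2) (Fin 2) ℂ) {a b : Fin d} (hab : a ≠ b) :
    siteOp M a * siteOp N b = siteOp N b * siteOp M a := by
  rw [siteOp_eq_insertOp, siteOp_eq_insertOp]
  refine (prodOp_mul _ _).trans (Eq.trans (congrArg prodOp (funext fun c => ?_))
    (prodOp_mul _ _).symm)
  by_cases ha : c = a
  · subst ha; simp [hab]
  · simp [ha]

theorem conjTranspose_siteOp (M : Matrix (Fin 2) (Fin 2) ℂ) (a : Fin d) :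
    (siteOp M a)ᴴ = siteOp Mᴴ a := by
  ext x y
  simp only [siteOp, Matrix.conjTranspose_apply, Matrix.of_apply, eq_comm (a := x _)]
  split_ifs <;> simp

theorem dissipator_siteOp (S M : Matrix (Fin 2) (Fin 2) ℂ) (a : Fin d)
    (u : Fin d → Matrix (Fin 2) (Fin 2) ℂ) :
    dissipator (siteOp S a) (insertOp a u M) = insertOp a u (dissipator S M) := by
  simp only [dissipator_apply, conjTranspose_siteOp, siteOp_mul, siteOp_mul_insertOp,
    insertOp_mul_siteOp, map_sub, map_add, map_smul]

theorem crossTerm_siteOp (S T M : Matrix (Fin 2) (Fin 2) ℂ) (a : Fin d)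
    (u : Fin d → Matrix (Fin 2) (Fin 2) ℂ) :
    crossTerm (siteOp S a) (siteOp T a) (insertOp a u M) = insertOp a u (crossTerm S T M) := by
  simp only [crossTerm_apply, conjTranspose_siteOp, siteOp_mul_insertOp, insertOp_mul_siteOp,
    map_add]

/-- Every `X_b` with `b ≠ a` commutes with an operator on site `a`, so Bohr frequencies are decided
on one qubit. -/
theorem hypercubeHamiltonian_commutator {M : Matrix (Fin 2) (Fin 2) ℂ} {ν : ℝ}
    (h : pauliX * M - M * pauliX = (ν : ℂ) • M) (a : Fin d) :
    hypercubeHamiltonian d * siteOp M a - siteOp M a * hypercubeHamiltonian d =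
      (ν : ℂ) • siteOp M a := by
  unfold hypercubeHamiltonian
  rw [Finset.sum_mul, Finset.mul_sum, ← Finset.sum_sub_distrib,
    Finset.sum_eq_single_of_mem a (Finset.mem_univ a)
      fun b _ hb => sub_eq_zero.2 (siteOp_commute _ _ hb),
    siteOp_mul, siteOp_mul, siteOp_eq_insertOp, siteOp_eq_insertOp, siteOp_eq_insertOp,
    ← map_sub, h, map_smul]

/-! ### One qubit: jump components, generator and eigenoperators. -/

/-- The part `c |+⟩⟨-|` of `c Z`, which raises the energy of a qubit by `2`. -/
def raising (c : ℂ) : Matrix (Fin 2) (Fin 2) ℂ := !![c / 2, -c / 2; c / 2, -c / 2]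

/-- The part `c |-⟩⟨+|` of `c Z`, which lowers the energy of a qubit by `2`. -/
def lowering (c : ℂ) : Matrix (Fin 2) (Fin 2) ℂ := !![c / 2, c / 2; -c / 2, -c / 2]

theorem raising_add_lowering (c : ℂ) : raising c + lowering c = c • pauliZ := by
  ext i j
  fin_cases i <;> fin_cases j <;> simp [raising, lowering, pauliZ] <;> ring

theorem pauliX_commutator_raising (c : ℂ) :
    pauliX * raising c - raising c * pauliX = ((2 : ℝ) : ℂ) • raising c := by
  ext i j
  fin_cases i <;> fin_cases j <;> simp [raising, pauliX] <;> ring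

theorem pauliX_commutator_lowering (c : ℂ) :
    pauliX * lowering c - lowering c * pauliX = ((-2 : ℝ) : ℂ) • lowering c := by
  ext i j
  fin_cases i <;> fin_cases j <;> simp [lowering, pauliX] <;> ring

theorem conjTranspose_raising (c : ℝ) : (raising c)ᴴ = lowering c := by
  ext i j
  fin_cases i <;> fin_cases j <;> simp [raising, lowering, Complex.conj_ofReal]

theorem conjTranspose_lowering (c : ℝ) : (lowering c)ᴴ = raising c := by
  rw [← conjTranspose_raising, Matrix.conjTranspose_conjTranspose]

theorem raising_mul_self (c : ℂ) : raising c * raising c = 0 := by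
  ext i j
  fin_cases i <;> fin_cases j <;> simp [raising] <;> ring

theorem lowering_mul_self (c : ℂ) : lowering c * lowering c = 0 := by
  ext i j
  fin_cases i <;> fin_cases j <;> simp [lowering] <;> ring

theorem hypercubeJump_eq (a : Fin d) :
    hypercubeJump d a = siteOp (raising ((1 / Real.sqrt d : ℝ) : ℂ)) a +
      siteOp (lowering ((1 / Real.sqrt d : ℝ) : ℂ)) a := by
  rw [hypercubeJump, siteOp_eq_insertOp, siteOp_eq_insertOp, siteOp_eq_insertOp, ← map_add,
    raising_add_lowering, map_smul]

/-- The generator of one qubit with pumping rate `p`, decay rate `q` and coherence transfer `k`,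
for jump operators scaled by `c`. -/
def qubitGenerator (p q k c : ℝ) : Matrix (Fin 2) (Fin 2) ℂ →ₗ[ℂ] Matrix (Fin 2) (Fin 2) ℂ :=
  (p : ℂ) • dissipator (raising c) + (q : ℂ) • dissipator (lowering c) +
    (k : ℂ) • crossTerm (raising c) (lowering c)

theorem hypercube_lindbladian_apply_prodOp {β σ : ℝ} (hβ : 0 ≤ β) (hσ : 0 < σ)
    (u : Fin d → Matrix (Fin 2) (Fin 2) ℂ) :
    lindbladian β σ (hypercubeHamiltonian_isHermitian d) (hypercubeJump d) (prodOp u) =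
      ∑ a, insertOp a u (qubitGenerator (theta β σ 2 2) (theta β σ (-2) (-2))
        (theta β σ 2 (-2)) (1 / Real.sqrt d) (u a)) := by
  rw [show hypercubeJump d = _ from funext hypercubeJump_eq,
    lindbladian_eq_sum (hypercubeHamiltonian_isHermitian d)
      (fun a => hypercubeHamiltonian_commutator (pauliX_commutator_raising _) a)
      (fun a => hypercubeHamiltonian_commutator (pauliX_commutator_lowering _) a)
      (fun a => by
        rw [conjTranspose_siteOp, siteOp_mul, conjTranspose_raising, lowering_mul_self,
          siteOp_eq_insertOp, map_zero])
      (fun a => by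
        rw [conjTranspose_siteOp, siteOp_mul, conjTranspose_lowering, raising_mul_self,
          siteOp_eq_insertOp, map_zero]) hβ hσ,
    LinearMap.sum_apply]
  refine Finset.sum_congr rfl fun a _ => ?_
  rw [← insertOp_self a u]
  simp only [qubitGenerator, LinearMap.add_apply, LinearMap.smul_apply, dissipator_siteOp,
    crossTerm_siteOp, map_add, map_smul]

/-- The eigenoperators of the generator of one qubit; `r` is the polarization of its stationary
state. -/
def qubitEigenop (r : ℂ) : Fin 4 → Matrix (Fin 2) (Fin 2) ℂ :=
  ![!![1 / 2, r / 2; r / 2, 1 / 2], pauliX, pauliZ, !![0, -1; 1, 0]]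

/-- The basis dual to `qubitEigenop`. -/
def qubitEigenopDual (r : ℂ) : Fin 4 → Matrix (Fin 2) (Fin 2) ℂ :=
  ![1, !![-r / 2, 1 / 2; 1 / 2, -r / 2], !![1 / 2, 0; 0, -1 / 2], !![0, -1 / 2; 1 / 2, 0]]

theorem qubitEigenopDual_pairing (r : ℂ) (i j : Fin 4) :
    ∑ p, ∑ q, qubitEigenopDual r i p q * qubitEigenop r j p q = if i = j then 1 else 0 := by
  fin_cases i <;> fin_cases j <;>
    simp [qubitEigenop, qubitEigenopDual, pauliX, pauliZ] <;> ring

/-- The eigenvalues of the generator of one qubit. -/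
def qubitEigenvalue (p q k : ℝ) : Fin 4 → ℝ :=
  ![0, -(p + q), -(p + q) / 2 + k, -(p + q) / 2 - k]

theorem qubitGenerator_qubitEigenop {p q : ℝ} (hpq : p + q ≠ 0) (k c : ℝ) (j : Fin 4) :
    qubitGenerator p q k c (qubitEigenop (((p - q) / (p + q) : ℝ) : ℂ) j) =
      ((c ^ 2 * qubitEigenvalue p q k j : ℝ) : ℂ) •
        qubitEigenop (((p - q) / (p + q) : ℝ) : ℂ) j := by
  obtain ⟨r, hr⟩ : ∃ r : ℝ, r = (p - q) / (p + q) := ⟨_, rfl⟩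
  -- This balance condition makes the `j = 0` operator stationary; the other three eigenoperators do
  -- not involve `r`.
  have hr' : (r : ℂ) * (p + q) = p - q := by
    rw [hr]
    exact_mod_cast div_mul_cancel₀ _ hpq
  rw [← hr]
  simp only [qubitGenerator, LinearMap.add_apply, LinearMap.smul_apply, dissipator_apply,
    crossTerm_apply, conjTranspose_raising, conjTranspose_lowering]
  ext a b
  fin_cases j <;> fin_cases a <;> fin_cases b <;>
    simp [qubitEigenop, qubitEigenvalue, raising, lowering, pauliX, pauliZ] <;>
    first | ring1 | linear_combination -((c : ℂ) ^ 2 / 2) * hr'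

/-! ### The product eigenbasis and the gap. -/

theorem linearIndependent_prodOp_qubitEigenop (r : ℂ) :
    LinearIndependent ℂ fun j : Fin d → Fin 4 => prodOp fun a => qubitEigenop r (j a) := by
  rw [Fintype.linearIndependent_iff]
  intro g hg i
  -- Products of the one-qubit dual operators are biorthogonal to the product family, so pairing
  -- with the `i`-th one extracts `g i`.
  have hpair : ∀ j : Fin d → Fin 4,
      ∑ x, ∑ y, prodOp (fun a => qubitEigenopDual r (i a)) x y *
        prodOp (fun a => qubitEigenop r (j a)) x y = if i = j then 1 else 0 := by
    intro j
    simp only [sum_prodOp_mul_prodOp, qubitEigenopDual_pairing]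
    rw [Finset.prod_ite_zero]
    simp [funext_iff]
  calc g i = ∑ j, g j * ∑ x, ∑ y, prodOp (fun a => qubitEigenopDual r (i a)) x y *
        prodOp (fun a => qubitEigenop r (j a)) x y := by simp [hpair]
    _ = ∑ x, ∑ y, prodOp (fun a => qubitEigenopDual r (i a)) x y *
        (∑ j, g j • prodOp fun a => qubitEigenop r (j a)) x y := by
      simp only [Matrix.sum_apply, Matrix.smul_apply, smul_eq_mul, Finset.mul_sum]
      rw [Finset.sum_comm]
      refine Finset.sum_congr rfl fun x _ => ?_
      rw [Finset.sum_comm]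
      exact Finset.sum_congr rfl fun y _ => Finset.sum_congr rfl fun j _ => by ring
    _ = 0 := by simp [hg]

/-- The product eigenbasis of the hypercube Lindbladian. -/
def prodEigenbasis (d : ℕ) (r : ℂ) :
    Module.Basis (Fin d → Fin 4) ℂ (Matrix (Fin d → Fin 2) (Fin d → Fin 2) ℂ) :=
  basisOfLinearIndependentOfCardEqFinrank (linearIndependent_prodOp_qubitEigenop r) (by
    rw [Module.finrank_matrix]
    simp [← mul_pow])

theorem prodEigenbasis_apply (d : ℕ) (r : ℂ) (j : Fin d → Fin 4) :
    prodEigenbasis d r j = prodOp fun a => qubitEigenop r (j a) := by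
  simp [prodEigenbasis]

theorem hypercube_lindbladian_prodEigenbasis {β σ : ℝ} (hβ : 0 ≤ β) (hσ : 0 < σ)
    {p q k : ℝ} (hp : theta β σ 2 2 = p) (hq : theta β σ (-2) (-2) = q)
    (hk : theta β σ 2 (-2) = k) (hpq : p + q ≠ 0) (j : Fin d → Fin 4) :
    lindbladian β σ (hypercubeHamiltonian_isHermitian d) (hypercubeJump d)
        (prodEigenbasis d (((p - q) / (p + q) : ℝ) : ℂ) j) =
      (((∑ a, qubitEigenvalue p q k (j a)) / d : ℝ) : ℂ) •
        prodEigenbasis d (((p - q) / (p + q) : ℝ) : ℂ) j := by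
  rw [prodEigenbasis_apply, hypercube_lindbladian_apply_prodOp hβ hσ, hp, hq, hk,
    Finset.sum_div, Complex.ofReal_sum, Finset.sum_smul]
  refine Finset.sum_congr rfl fun a _ => ?_
  rw [qubitGenerator_qubitEigenop hpq, map_smul,
    insertOp_self a fun a => qubitEigenop (((p - q) / (p + q) : ℝ) : ℂ) (j a)]
  -- The factor `1/d` is the square of the jump normalization `1/√d`.
  rw [div_pow, Real.sq_sqrt (Nat.cast_nonneg d), one_pow, one_div_mul_eq_div]

theorem le_spectralGap_hypercube {β σ : ℝ} (hβ : 0 ≤ β) (hσ : 0 < σ) (hd : 1 ≤ d) :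
    ((theta β σ 2 2 + theta β σ (-2) (-2)) / 2 - |theta β σ 2 (-2)|) / d ≤
      spectralGap (lindbladian β σ (hypercubeHamiltonian_isHermitian d) (hypercubeJump d)) := by
  have hlt := abs_theta_lt hβ hσ (ν := 2) two_ne_zero
  obtain ⟨p, hp⟩ : ∃ p, theta β σ 2 2 = p := ⟨_, rfl⟩
  obtain ⟨q, hq⟩ : ∃ q, theta β σ (-2) (-2) = q := ⟨_, rfl⟩
  obtain ⟨k, hk⟩ : ∃ k, theta β σ 2 (-2) = k := ⟨_, rfl⟩
  have hEig := fun h j => hypercube_lindbladian_prodEigenbasis (d := d) hβ hσ hp hq hk h j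
  rw [hp, hq, hk] at hlt ⊢
  have hk0 := abs_nonneg k
  have hk1 := neg_abs_le k
  have hk2 := le_abs_self k
  -- For the eigenvalue `-(p + q)` this uses `p + q > 0`, which follows from `hlt` and `|k| ≥ 0`.
  have hlam : ∀ i, i ≠ 0 → qubitEigenvalue p q k i ≤ -((p + q) / 2 - |k|) := by
    intro i hi
    fin_cases i
    · exact absurd rfl hi
    all_goals simp [qubitEigenvalue]; linarith
  have hlam0 : ∀ i, qubitEigenvalue p q k i ≤ 0 := by
    intro i
    by_cases hi : i = 0
    · simp [hi, qubitEigenvalue]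
    · have := hlam i hi
      linarith
  -- This makes the index type `Fin d → Fin 4` nontrivial, as the gap bound requires.
  have : Nonempty (Fin d) := ⟨⟨0, hd⟩⟩
  refine le_spectralGap_of_eigenbasis _ _ _ (hEig (by linarith)) 0
    (by simp [qubitEigenvalue]) _ fun j hj => ?_
  obtain ⟨a, ha⟩ := Function.ne_iff.1 hj
  rw [Complex.norm_real, Real.norm_eq_abs, abs_div, Nat.abs_cast]
  gcongr
  refine le_trans ?_ (neg_le_abs _)
  rw [le_neg]
  -- One site with a nonzero index already gives the bound; the others are nonpositive, so nothing
  -- cancels.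
  calc ∑ b, qubitEigenvalue p q k (j b)
      = qubitEigenvalue p q k (j a) + ∑ b ∈ Finset.univ.erase a, qubitEigenvalue p q k (j b) :=
        (Finset.add_sum_erase _ _ (Finset.mem_univ a)).symm
    _ ≤ -((p + q) / 2 - |k|) + 0 :=
        add_le_add (hlam _ ha) (Finset.sum_nonpos fun b _ => hlam0 _)
    _ = _ := add_zero _

end Hypercube

end CKG

end

theorem theorem5 (β : ℝ) (hβ : 0 < β) :
    ∃ σE : ℝ, 0 < σE ∧ ∃ c : ℝ, 0 < c ∧ ∀ d : ℕ, 1 ≤ d →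
      c / (d : ℝ) ≤
        CKG.spectralGap
          (CKG.lindbladian β σE (CKG.hypercubeHamiltonian_isHermitian d)
            (CKG.hypercubeJump d)) :=
  -- The choice `σE = 1` is arbitrary, since the strict inequality holds for every positive
  -- resolution. The constant is `(θ(2,2) + θ(-2,-2))/2 - |θ(2,-2)|`, which does not involve `d`.
  ⟨1, one_pos, _, sub_pos.2 (CKG.abs_theta_lt hβ.le one_pos two_ne_zero),
    fun _ hd => CKG.le_spectralGap_hypercube hβ.le one_pos hd⟩
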